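/- Let $M,N\in\mathbb{N}$ and let $\mathbb{M}_{M,N}$ be the space of real or complex $M\times N$ matrices with the Frobenius norm $\|\cdot\|$ and the real scalar product $\langle A,X\rangle=\mathrm{Re}\,\mathrm{tr}(AX^*)$; pairs of matrices carry $\langle (A,B),(X,Y)\rangle=\langle A,X\rangle+\langle B,Y\rangle$. Let $\sigma_j(A)$, $1\le j\le\min(M,N)$, be the singular values of $A$, and for $\tau>0$ put $$\mathcal{S}_\tau(A)=\sum_j\max\big(\sigma_j(A)^2-\tau^2,0\big),\qquad \mathcal{R}_\tau(A)=\sum_j\Big(\tau^2-\max\big(\tau-\sigma_j(A),0\big)^2\Big).$$ The Fenchel conjugate of a real-valued function $f$ is $f^*(y)=\max_x\big(\langle x,y\rangle-f(x)\big)$, and its convex envelope is the greatest convex function $g\le f$. Let $F\in\mathbb{M}_{M,N}$, $\tau>0$ and $1<p,q<\infty$ with $1/p+1/q=1$, and let $$\mathscr{K}(A,B)=\tau^2\,\mathrm{rank}(A)+p\|A-B\|^2+q\|B-F\|^2 .$$ Then the Fenchel conjugate of $\mathscr{K}$ is (with the maximum attained) $$\mathscr{K}^*(X,Y)=\mathcal{S}_\tau\Big(\frac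 X2+\frac Y{2q}+F\Big)+(q-1)\Big\|\frac Y{2q}+F\Big\|^2-q\|F\|^2 .$$ Its Fenchel bi-conjugate (again with the maximum attained) is $$\mathscr{K}^{**}(A,B)=\mathcal{R}_\tau(A)+p\|A-B\|^2+q\|B-F\|^2 ,$$ and $\mathscr{K}^{**}$ is the convex envelope of $\mathscr{K}$. -/

import Mathlib

open scoped Matrix Matrix.Norms.Frobenius

/-- `g` is the Fenchel conjugate of the real-valued function `f` with respect to the pairing `b`:
`g y = max_x (b x y - f x)`. The maximum is attained, so `g` is determined by `f`. -/
def IsFenchelConjugate {E : Type*} (b : E → E → ℝ) (f g : E → ℝ) : Prop :=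
  ∀ y, IsGreatest (Set.range fun x => b x y - f x) (g y)

/-- `g` is the convex envelope of `f`: the greatest convex function below `f`. -/
def IsConvexEnvelope {E : Type*} [AddCommGroup E] [Module ℝ E] (f g : E → ℝ) : Prop :=
  IsGreatest {h : E → ℝ | ConvexOn ℝ Set.univ h ∧ ∀ x, h x ≤ f x} g

namespace RankEnvelope

variable {𝕜 : Type*} [RCLike 𝕜] {M N : ℕ}

/-- The Euclidean (real) scalar product on `M × N` matrices belonging to the Frobenius norm,
`Re tr (A Xᴴ)`. Over `ℝ` this is `tr (A Xᵀ)`. -/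
noncomputable def frobInner (A X : Matrix (Fin M) (Fin N) 𝕜) : ℝ :=
  RCLike.re (A * Xᴴ).trace

theorem frobInner_self (A : Matrix (Fin M) (Fin N) 𝕜) : frobInner A A = ‖A‖ ^ 2 := by
  have h : ‖A‖ ^ 2 = ∑ i, ∑ j, ‖A i j‖ ^ 2 := by
    rw [Matrix.frobenius_norm_def, ← Real.rpow_natCast, ← Real.rpow_mul (by positivity)]
    simp
  rw [h]
  simp only [frobInner, Matrix.trace, Matrix.diag_apply, Matrix.mul_apply,
    Matrix.conjTranspose_apply, map_sum, RCLike.star_def, RCLike.mul_conj]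
  norm_cast

/-- The induced scalar product on pairs of matrices, `⟨A, X⟩ + ⟨B, Y⟩`. -/
noncomputable def pairInner
    (P Q : Matrix (Fin M) (Fin N) 𝕜 × Matrix (Fin M) (Fin N) 𝕜) : ℝ :=
  frobInner P.1 Q.1 + frobInner P.2 Q.2

/-- The singular values of `A`, in decreasing order and indexed from `0`. -/
noncomputable def sv (A : Matrix (Fin M) (Fin N) 𝕜) (j : ℕ) : ℝ :=
  (Matrix.toEuclideanLin A).singularValues j

/-- `S_τ(A) = ∑_j max (σ_j(A)² - τ², 0)`. -/
noncomputable def S (τ : ℝ) (A : Matrix (Fin M) (Fin N) 𝕜) : ℝ :=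
  ∑ j ∈ Finset.range (min M N), max (sv A j ^ 2 - τ ^ 2) 0

/-- `R_τ(A) = ∑_j (τ² - (max (τ - σ_j(A), 0))²)`. -/
noncomputable def R (τ : ℝ) (A : Matrix (Fin M) (Fin N) 𝕜) : ℝ :=
  ∑ j ∈ Finset.range (min M N), (τ ^ 2 - max (τ - sv A j) 0 ^ 2)

/-- `K(A, B) = τ² rank A + p ‖A - B‖² + q ‖B - F‖²`. -/
noncomputable def K (F : Matrix (Fin M) (Fin N) 𝕜) (τ p q : ℝ)
    (P : Matrix (Fin M) (Fin N) 𝕜 × Matrix (Fin M) (Fin N) 𝕜) : ℝ :=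
  τ ^ 2 * (P.1.rank : ℝ) + p * ‖P.1 - P.2‖ ^ 2 + q * ‖P.2 - F‖ ^ 2

end RankEnvelope

/-! Completing the square in `B` turns `⟨(A,B),(X,Y)⟩ - K(A,B)` into `2⟨A,Z⟩ - ‖A‖² - τ² rank A`,
with `Z = X/2 + Y/(2q) + F`, plus terms in `Y` and `F`, minus a square that a choice of `B`
annihilates. Completing the square in `Y` treats the second conjugate likewise and leaves `2⟨A,Z⟩ -
S(Z)`. Two maximisations over one matrix remain: `S_isGreatest` and `R_isGreatest`. Both reduce to
scalar inequalities through a thin SVD and Bessel's inequality, with no trace inequality of von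
Neumann type. Finally, a biconjugate is the convex envelope because convex functions are suprema of
affine minorants (`isConvexEnvelope_of_biconjugate`). -/

namespace RankEnvelope

section

variable {𝕜 : Type*} [RCLike 𝕜] {M N m n r : ℕ}

/-! ### The Frobenius pairing, isometries and Bessel bounds. -/

theorem frobInner_comm (A X : Matrix (Fin M) (Fin N) 𝕜) : frobInner A X = frobInner X A := by
  have h : X * Aᴴ = (A * Xᴴ)ᴴ := by simp
  rw [frobInner, frobInner, h, Matrix.trace_conjTranspose, RCLike.star_def, RCLike.conj_re]

theorem frobInner_add_left (A B X : Matrix (Fin M) (Fin N) 𝕜) :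
    frobInner (A + B) X = frobInner A X + frobInner B X := by
  simp [frobInner, Matrix.add_mul]

theorem frobInner_sub_left (A B X : Matrix (Fin M) (Fin N) 𝕜) :
    frobInner (A - B) X = frobInner A X - frobInner B X := by
  simp [frobInner, Matrix.sub_mul]

theorem frobInner_smul_left (c : ℝ) (A X : Matrix (Fin M) (Fin N) 𝕜) :
    frobInner (c • A) X = c * frobInner A X := by
  simp [frobInner, RCLike.smul_re]

theorem frobInner_add_right (A B X : Matrix (Fin M) (Fin N) 𝕜) :
    frobInner X (A + B) = frobInner X A + frobInner X B := by
  simp only [frobInner_comm X, frobInner_add_left]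

theorem frobInner_sub_right (A B X : Matrix (Fin M) (Fin N) 𝕜) :
    frobInner X (A - B) = frobInner X A - frobInner X B := by
  simp only [frobInner_comm X, frobInner_sub_left]

theorem frobInner_smul_right (c : ℝ) (A X : Matrix (Fin M) (Fin N) 𝕜) :
    frobInner X (c • A) = c * frobInner X A := by
  simp only [frobInner_comm X, frobInner_smul_left]

theorem frobInner_mul_left (Q : Matrix (Fin M) (Fin m) 𝕜) (A : Matrix (Fin m) (Fin N) 𝕜)
    (X : Matrix (Fin M) (Fin N) 𝕜) : frobInner (Q * A) X = frobInner A (Qᴴ * X) := by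
  rw [frobInner, frobInner, Matrix.conjTranspose_mul, Matrix.conjTranspose_conjTranspose,
    Matrix.mul_assoc, Matrix.trace_mul_comm, Matrix.mul_assoc]

theorem frobInner_mul_right (A : Matrix (Fin M) (Fin m) 𝕜) (B : Matrix (Fin m) (Fin N) 𝕜)
    (X : Matrix (Fin M) (Fin N) 𝕜) : frobInner (A * B) X = frobInner A (X * Bᴴ) := by
  rw [frobInner, frobInner, Matrix.conjTranspose_mul, Matrix.conjTranspose_conjTranspose,
    Matrix.mul_assoc]

theorem frobenius_norm_sq (A : Matrix (Fin M) (Fin N) 𝕜) : ‖A‖ ^ 2 = ∑ i, ∑ j, ‖A i j‖ ^ 2 := by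
  rw [Matrix.frobenius_norm_def, ← Real.rpow_natCast, ← Real.rpow_mul (by positivity)]
  simp

theorem two_mul_frobInner_sub_le (A Z : Matrix (Fin M) (Fin N) 𝕜) :
    2 * frobInner A Z - ‖A‖ ^ 2 ≤ ‖Z‖ ^ 2 := by
  have h := sq_nonneg ‖A - Z‖
  rw [← frobInner_self] at h
  simp only [frobInner_sub_left, frobInner_sub_right, frobInner_comm Z A] at h
  rw [← frobInner_self, ← frobInner_self]
  linarith

/-- Multiplication from the left by a matrix with orthonormal columns is isometric. -/
theorem norm_sq_isometry_mul {Q : Matrix (Fin M) (Fin m) 𝕜} (hQ : Qᴴ * Q = 1)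
    (C : Matrix (Fin m) (Fin N) 𝕜) : ‖Q * C‖ ^ 2 = ‖C‖ ^ 2 := by
  rw [← frobInner_self, ← frobInner_self, frobInner_mul_left, ← Matrix.mul_assoc, hQ,
    Matrix.one_mul]

theorem norm_sq_mul_isometry {V : Matrix (Fin N) (Fin m) 𝕜} (hV : Vᴴ * V = 1)
    (C : Matrix (Fin M) (Fin m) 𝕜) : ‖C * Vᴴ‖ ^ 2 = ‖C‖ ^ 2 := by
  rw [← frobInner_self, ← frobInner_self, frobInner_mul_right, Matrix.mul_assoc,
    Matrix.conjTranspose_conjTranspose, hV, Matrix.mul_one]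

/-- Bessel's inequality. -/
theorem norm_sq_conjTranspose_mul_le {Q : Matrix (Fin M) (Fin m) 𝕜} (hQ : Qᴴ * Q = 1)
    (C : Matrix (Fin M) (Fin N) 𝕜) : ‖Qᴴ * C‖ ^ 2 ≤ ‖C‖ ^ 2 := by
  have h := two_mul_frobInner_sub_le (Q * (Qᴴ * C)) C
  rw [frobInner_mul_left, frobInner_self, norm_sq_isometry_mul hQ] at h
  linarith

theorem norm_sq_of_isometry {Q : Matrix (Fin M) (Fin m) 𝕜} (hQ : Qᴴ * Q = 1) :
    ‖Q‖ ^ 2 = m := by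
  rw [← frobInner_self, frobInner, Matrix.trace_mul_comm, hQ]
  simp

theorem isometry_col_sum {Q : Matrix (Fin M) (Fin m) 𝕜} (hQ : Qᴴ * Q = 1) (i : Fin m) :
    ∑ k, ‖Q k i‖ ^ 2 = 1 := by
  have h := congrArg RCLike.re (congrFun (congrFun hQ i) i)
  simp only [Matrix.mul_apply, Matrix.conjTranspose_apply, RCLike.star_def, RCLike.conj_mul,
    map_sum, Matrix.one_apply_eq, RCLike.one_re] at h
  rw [← h]
  refine Finset.sum_congr rfl fun k _ => ?_
  norm_cast

theorem col_sum_conjTranspose_mul_le {Q : Matrix (Fin M) (Fin m) 𝕜} (hQ : Qᴴ * Q = 1)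
    {U : Matrix (Fin M) (Fin n) 𝕜} (hU : Uᴴ * U = 1) (i : Fin n) :
    ∑ k, ‖(Qᴴ * U) k i‖ ^ 2 ≤ 1 := by
  have h := norm_sq_conjTranspose_mul_le hQ (U.submatrix id fun _ : Fin 1 => i)
  rw [frobenius_norm_sq, frobenius_norm_sq] at h
  simp only [Finset.univ_unique, Finset.sum_singleton, Matrix.submatrix_apply, id,
    isometry_col_sum hU] at h
  exact h

/-- Bessel with the roles exchanged: the total is `‖Uᴴ Q‖²`, bounded by `‖Q‖²`. -/
theorem sum_conjTranspose_mul_le {Q : Matrix (Fin M) (Fin m) 𝕜} (hQ : Qᴴ * Q = 1)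
    {U : Matrix (Fin M) (Fin n) 𝕜} (hU : Uᴴ * U = 1) :
    ∑ i, ∑ k, ‖(Qᴴ * U) k i‖ ^ 2 ≤ m := by
  rw [Finset.sum_comm, ← frobenius_norm_sq, ← Matrix.frobenius_norm_conjTranspose,
    Matrix.conjTranspose_mul, Matrix.conjTranspose_conjTranspose, ← norm_sq_of_isometry hQ]
  exact norm_sq_conjTranspose_mul_le hU Q

theorem frobInner_diagonal_left (U : Matrix (Fin M) (Fin n) 𝕜) (V : Matrix (Fin N) (Fin n) 𝕜)
    (d : Fin n → ℝ) (Z : Matrix (Fin M) (Fin N) 𝕜) :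
    frobInner (U * Matrix.diagonal (fun i => (d i : 𝕜)) * Vᴴ) Z =
      ∑ i, d i * RCLike.re ((Uᴴ * Z * V) i i) := by
  rw [frobInner_mul_right, Matrix.conjTranspose_conjTranspose, frobInner_mul_left,
    ← Matrix.mul_assoc, frobInner, Matrix.trace, map_sum]
  refine Finset.sum_congr rfl fun i _ => ?_
  rw [Matrix.diag_apply, Matrix.diagonal_mul, Matrix.conjTranspose_apply, RCLike.re_ofReal_mul,
    RCLike.star_def, RCLike.conj_re]

theorem conjTranspose_mul_diagonal_mul {U : Matrix (Fin M) (Fin n) 𝕜}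
    {V : Matrix (Fin N) (Fin n) 𝕜} (hU : Uᴴ * U = 1) (hV : Vᴴ * V = 1)
    (D : Matrix (Fin n) (Fin n) 𝕜) : Uᴴ * (U * D * Vᴴ) * V = D := by
  rw [Matrix.mul_assoc, Matrix.mul_assoc, Matrix.mul_assoc, hV, Matrix.mul_one,
    ← Matrix.mul_assoc, hU, Matrix.one_mul]

theorem frobInner_diagonal_diagonal {U : Matrix (Fin M) (Fin n) 𝕜}
    {V : Matrix (Fin N) (Fin n) 𝕜} (hU : Uᴴ * U = 1) (hV : Vᴴ * V = 1) (d e : Fin n → ℝ) :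
    frobInner (U * Matrix.diagonal (fun i => (d i : 𝕜)) * Vᴴ)
      (U * Matrix.diagonal (fun i => (e i : 𝕜)) * Vᴴ) = ∑ i, d i * e i := by
  rw [frobInner_diagonal_left, conjTranspose_mul_diagonal_mul hU hV]
  simp

/-! ### Thin singular value decomposition. -/

/-- A singular value decomposition that keeps only the nonzero singular values. -/
theorem exists_svd (Z : Matrix (Fin M) (Fin N) 𝕜) :
    ∃ (U : Matrix (Fin M) (Fin Z.rank) 𝕜) (V : Matrix (Fin N) (Fin Z.rank) 𝕜),
      Uᴴ * U = 1 ∧ Vᴴ * V = 1 ∧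
        Z = U * Matrix.diagonal (fun i : Fin Z.rank => (sv Z i : 𝕜)) * Vᴴ := by
  set T := Matrix.toEuclideanLin Z with hTdef
  have hrank : Z.rank = Module.finrank 𝕜 T.range := Matrix.rank_eq_finrank_range_toLin Z
    (EuclideanSpace.basisFun _ 𝕜).toBasis (EuclideanSpace.basisFun _ 𝕜).toBasis
  have hT := T.isSymmetric_adjoint_comp_self
  have hn : Module.finrank 𝕜 (EuclideanSpace 𝕜 (Fin N)) = N := by simp
  set v := hT.eigenvectorBasis hn with hv
  have hle : Z.rank ≤ N := by simpa using Z.rank_le_width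
  have hpos (i : Fin Z.rank) : 0 < sv Z i :=
    T.singularValues_pos_iff_lt_finrank_range.2 (hrank ▸ i.2)
  have hTT (i j : Fin N) : inner 𝕜 (T (v i)) (T (v j)) =
      if i = j then ((sv Z j : 𝕜)) ^ 2 else 0 := by
    rw [← LinearMap.adjoint_inner_right, ← LinearMap.comp_apply,
      hT.apply_eigenvectorBasis hn j, inner_smul_right,
      orthonormal_iff_ite.1 v.orthonormal i j, ← T.sq_singularValues_fin hn j]
    simp [sv, hTdef]
  let c : Fin Z.rank → Fin N := Fin.castLE hle
  -- The columns of `V` are eigenvectors `v` of `T*T`; those of `U` are `T v / σ`, where `σ > 0`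
  -- because only indices below the rank occur.
  refine ⟨.of fun i j => ((sv Z j : 𝕜))⁻¹ * T (v (c j)) i, .of fun i j => v (c j) i, ?_, ?_, ?_⟩
  · ext i j
    have h := hTT (c i) (c j)
    have hj : ((sv Z j : ℝ) : 𝕜) ≠ 0 := by exact_mod_cast (hpos j).ne'
    rw [PiLp.inner_apply] at h
    have hsum : ((Matrix.of fun i j => ((sv Z j : 𝕜))⁻¹ * T (v (c j)) i :
        Matrix (Fin M) (Fin Z.rank) 𝕜)ᴴ * (Matrix.of fun i j => ((sv Z j : 𝕜))⁻¹ * T (v (c j)) i :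
        Matrix (Fin M) (Fin Z.rank) 𝕜)) i j = ((sv Z i : 𝕜))⁻¹ * ((sv Z j : 𝕜))⁻¹ *
          ∑ k, inner 𝕜 (T (v (c i)) k) (T (v (c j)) k) := by
      rw [Matrix.mul_apply, Finset.mul_sum]
      refine Finset.sum_congr rfl fun k _ => ?_
      simp only [Matrix.conjTranspose_apply, Matrix.of_apply, RCLike.star_def, map_mul, map_inv₀,
        RCLike.conj_ofReal, RCLike.inner_apply]
      ring
    rw [hsum, h, Matrix.one_apply]
    have hc : c i = c j ↔ i = j := (Fin.castLE_injective hle).eq_iff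
    by_cases hij : i = j
    · subst hij
      rw [if_pos rfl, if_pos rfl]
      simp only [c, Fin.val_castLE]
      field_simp
    · rw [if_neg (hc.not.2 hij), if_neg hij, mul_zero]
  · ext i j
    have h := orthonormal_iff_ite.1 v.orthonormal (c i) (c j)
    rw [PiLp.inner_apply] at h
    rw [Matrix.mul_apply, Matrix.one_apply]
    simp only [(Fin.castLE_injective hle).eq_iff, c, RCLike.inner_apply] at h
    rw [← h]
    refine Finset.sum_congr rfl fun k _ => ?_
    simp [c, mul_comm]
  · apply Matrix.toEuclideanLin.injective
    refine v.toBasis.ext fun k => ?_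
    rw [OrthonormalBasis.coe_toBasis, ← hTdef]
    ext a
    conv_rhs => rw [Matrix.toLpLin_apply, ← Matrix.mulVec_mulVec, ← Matrix.mulVec_mulVec]
    have hk : (Matrix.of fun i j => v (c j) i : Matrix (Fin N) (Fin Z.rank) 𝕜)ᴴ *ᵥ
        (WithLp.ofLp (v k)) = fun j => if c j = k then 1 else 0 := by
      funext j
      have h := orthonormal_iff_ite.1 v.orthonormal (c j) k
      rw [PiLp.inner_apply] at h
      rw [← h, Matrix.mulVec, dotProduct]
      refine Finset.sum_congr rfl fun l _ => ?_
      simp [mul_comm]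
    have hD : Matrix.diagonal (fun i : Fin Z.rank => (sv Z i : 𝕜)) *ᵥ
        (fun j => if c j = k then 1 else 0) = fun j => if c j = k then (sv Z j : 𝕜) else 0 := by
      funext j
      rw [Matrix.mulVec_diagonal, mul_ite, mul_one, mul_zero]
    rw [hk, hD]
    simp only [Matrix.mulVec, dotProduct, Matrix.of_apply, mul_ite, mul_zero]
    by_cases hkr : (k : ℕ) < Z.rank
    · have hck : ∀ j, c j = k ↔ j = ⟨k, hkr⟩ := fun j => by simp [c, Fin.ext_iff]
      have hj : ((sv Z k : ℝ) : 𝕜) ≠ 0 := by exact_mod_cast (hpos ⟨k, hkr⟩).ne'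
      simp only [hck, Finset.sum_ite_eq', Finset.mem_univ, if_true]
      have : c ⟨k, hkr⟩ = k := (hck _).2 rfl
      rw [this]
      field_simp
    · rw [Finset.sum_eq_zero]
      · have h0 : sv Z k = 0 :=
          T.singularValues_eq_zero_iff_le_finrank_range.2 (hrank ▸ not_lt.1 hkr)
        have h := hTT k k
        rw [if_pos rfl, h0] at h
        simp only [RCLike.ofReal_zero, ne_eq, OfNat.ofNat_ne_zero, not_false_eq_true, zero_pow,
          inner_self_eq_zero] at h
        rw [h]
        rfl
      · intro j _
        refine if_neg ?_
        rintro rfl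
        exact hkr j.2

theorem sv_nonneg (A : Matrix (Fin M) (Fin N) 𝕜) (j : ℕ) : 0 ≤ sv A j :=
  LinearMap.singularValues_nonneg _ _

theorem sum_range_sv (A : Matrix (Fin M) (Fin N) 𝕜) {g : ℝ → ℝ} (hg : g 0 = 0) :
    ∑ j ∈ Finset.range (min M N), g (sv A j) = ∑ i : Fin A.rank, g (sv A i) := by
  have hrank : A.rank = Module.finrank 𝕜 (Matrix.toEuclideanLin A).range :=
    Matrix.rank_eq_finrank_range_toLin A
      (EuclideanSpace.basisFun _ 𝕜).toBasis (EuclideanSpace.basisFun _ 𝕜).toBasis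
  rw [Fin.sum_univ_eq_sum_range fun j => g (sv A j)]
  symm
  refine Finset.sum_subset (Finset.range_subset_range.2 (le_min ?_ ?_)) fun j _ hj => ?_
  · simpa using A.rank_le_height
  · simpa using A.rank_le_width
  · have h0 : sv A j = 0 := (Matrix.toEuclideanLin A).singularValues_eq_zero_iff_le_finrank_range.2
      (hrank ▸ not_lt.1 (by simpa using hj))
    rw [h0, hg]

/-! ### The two maximisation problems over a single matrix. -/

/-- Write `X = Q C` with `rank X` orthonormal columns in `Q`. Optimising over `C` leaves `‖Qᴴ Z‖² =
∑ dᵢ² wᵢ`, where the weights `wᵢ = ‖Qᴴ uᵢ‖²` lie in `[0,1]` and sum to at most `rank X`. -/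
theorem sub_rank_le {U : Matrix (Fin M) (Fin n) 𝕜}
    {V : Matrix (Fin N) (Fin n) 𝕜} (hU : Uᴴ * U = 1) (hV : Vᴴ * V = 1) (d : Fin n → ℝ) (τ : ℝ)
    (X : Matrix (Fin M) (Fin N) 𝕜) :
    2 * frobInner X (U * Matrix.diagonal (fun i => (d i : 𝕜)) * Vᴴ) - ‖X‖ ^ 2 - τ ^ 2 * X.rank ≤
      ∑ i, max (d i ^ 2 - τ ^ 2) 0 := by
  obtain ⟨Q, W, hQ, -, hX⟩ := exists_svd X
  set Z := U * Matrix.diagonal (fun i => (d i : 𝕜)) * Vᴴ with hZ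
  set C := Matrix.diagonal (fun i : Fin X.rank => (sv X i : 𝕜)) * Wᴴ
  have hXC : X = Q * C := by rw [← Matrix.mul_assoc]; exact hX
  have h1 : 2 * frobInner X Z - ‖X‖ ^ 2 ≤ ‖Qᴴ * Z‖ ^ 2 := by
    have e1 : frobInner X Z = frobInner C (Qᴴ * Z) := by
      conv_lhs => rw [hXC]
      exact frobInner_mul_left _ _ _
    have e2 : ‖X‖ ^ 2 = ‖C‖ ^ 2 := by
      conv_lhs => rw [hXC]
      exact norm_sq_isometry_mul hQ _
    rw [e1, e2]
    exact two_mul_frobInner_sub_le _ _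
  have h2 : ‖Qᴴ * Z‖ ^ 2 = ∑ i, d i ^ 2 * ∑ k, ‖(Qᴴ * U) k i‖ ^ 2 := by
    rw [hZ, ← Matrix.mul_assoc, ← Matrix.mul_assoc, norm_sq_mul_isometry hV, frobenius_norm_sq,
      Finset.sum_comm]
    refine Finset.sum_congr rfl fun i _ => ?_
    rw [Finset.mul_sum]
    refine Finset.sum_congr rfl fun k _ => ?_
    rw [Matrix.mul_diagonal, norm_mul, mul_pow, RCLike.norm_ofReal, sq_abs, mul_comm]
  have h3 := mul_le_mul_of_nonneg_left (sum_conjTranspose_mul_le hQ hU) (sq_nonneg τ)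
  have h4 : ∑ i, d i ^ 2 * ∑ k, ‖(Qᴴ * U) k i‖ ^ 2 - τ ^ 2 * ∑ i, ∑ k, ‖(Qᴴ * U) k i‖ ^ 2 ≤
      ∑ i, max (d i ^ 2 - τ ^ 2) 0 := by
    rw [Finset.mul_sum, ← Finset.sum_sub_distrib]
    refine Finset.sum_le_sum fun i _ => ?_
    have h0 : 0 ≤ ∑ k, ‖(Qᴴ * U) k i‖ ^ 2 := by positivity
    have h1 := col_sum_conjTranspose_mul_le hQ hU i
    rw [← sub_mul]
    rcases le_total (d i ^ 2 - τ ^ 2) 0 with h | h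
    · rw [max_eq_right h]; exact mul_nonpos_of_nonpos_of_nonneg h h0
    · rw [max_eq_left h]; exact mul_le_of_le_one_right h h1
  linarith

theorem rank_mul_diagonal_mul_le (U : Matrix (Fin M) (Fin n) 𝕜) (V : Matrix (Fin n) (Fin N) 𝕜)
    (d : Fin n → ℝ) :
    ((U * Matrix.diagonal (fun i => (d i : 𝕜)) * V).rank : ℝ) ≤
      ∑ i, if d i = 0 then (0 : ℝ) else 1 := by
  have h : (U * Matrix.diagonal (fun i => (d i : 𝕜)) * V).rank ≤
      (Matrix.diagonal (fun i => (d i : 𝕜))).rank :=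
    (Matrix.rank_mul_le_left _ _).trans (Matrix.rank_mul_le_right _ _)
  rw [Matrix.rank_diagonal, Fintype.card_subtype] at h
  refine (Nat.cast_le.2 h).trans_eq ?_
  rw [Finset.card_filter]
  push_cast
  refine Finset.sum_congr rfl fun i _ => ?_
  simp only [ne_eq, RCLike.ofReal_eq_zero, ite_not]

/-- The witness is hard thresholding of `z`. The pairing with it sees only the diagonal of `Uᴴ Z V`,
so `Z` may be arbitrary; `R_isGreatest` needs this generality. -/
theorem sum_max_sq_sub_le {U : Matrix (Fin M) (Fin n) 𝕜}
    {V : Matrix (Fin N) (Fin n) 𝕜} (hU : Uᴴ * U = 1) (hV : Vᴴ * V = 1) {τ : ℝ} (hτ : 0 < τ)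
    (Z : Matrix (Fin M) (Fin N) 𝕜) (z : Fin n → ℝ)
    (hz : ∀ i, z i = RCLike.re ((Uᴴ * Z * V) i i)) :
    ∃ X : Matrix (Fin M) (Fin N) 𝕜, ∑ i, (if τ < z i then z i ^ 2 - τ ^ 2 else 0) ≤
      2 * frobInner X Z - ‖X‖ ^ 2 - τ ^ 2 * X.rank := by
  set d : Fin n → ℝ := fun i => if τ < z i then z i else 0 with hd
  refine ⟨U * Matrix.diagonal (fun i => (d i : 𝕜)) * Vᴴ, ?_⟩
  have hr := mul_le_mul_of_nonneg_left (rank_mul_diagonal_mul_le U Vᴴ d) (sq_nonneg τ)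
  refine le_trans (le_of_eq ?_) (sub_le_sub_left hr _)
  rw [← frobInner_self, frobInner_diagonal_diagonal hU hV, frobInner_diagonal_left, Finset.mul_sum,
    Finset.mul_sum, ← Finset.sum_sub_distrib, ← Finset.sum_sub_distrib]
  refine Finset.sum_congr rfl fun i _ => ?_
  rw [← hz]
  by_cases h : τ < z i
  · have h0 : z i ≠ 0 := (hτ.trans h).ne'
    simp only [hd, if_pos h, if_neg h0]
    ring
  · simp [hd, if_neg h]

theorem isGreatest_sum_max_sq_sub {U : Matrix (Fin M) (Fin n) 𝕜}
    {V : Matrix (Fin N) (Fin n) 𝕜} (hU : Uᴴ * U = 1) (hV : Vᴴ * V = 1) {τ : ℝ} (hτ : 0 < τ)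
    {d : Fin n → ℝ} (hd : ∀ i, 0 ≤ d i) :
    IsGreatest (Set.range fun X : Matrix (Fin M) (Fin N) 𝕜 =>
      2 * frobInner X (U * Matrix.diagonal (fun i => (d i : 𝕜)) * Vᴴ) - ‖X‖ ^ 2 - τ ^ 2 * X.rank)
      (∑ i, max (d i ^ 2 - τ ^ 2) 0) := by
  obtain ⟨X, hX⟩ := sum_max_sq_sub_le hU hV hτ
    (U * Matrix.diagonal (fun i => (d i : 𝕜)) * Vᴴ) d fun i => by
      rw [conjTranspose_mul_diagonal_mul hU hV]; simp
  refine ⟨⟨X, le_antisymm (sub_rank_le hU hV d τ X) (le_trans (le_of_eq ?_) hX)⟩, ?_⟩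
  · refine Finset.sum_congr rfl fun i _ => ?_
    split_ifs with h
    · exact max_eq_left (sub_nonneg.2 (pow_le_pow_left₀ hτ.le h.le 2))
    · exact max_eq_right (sub_nonpos.2 (pow_le_pow_left₀ (hd i) (not_lt.1 h) 2))
  · rintro _ ⟨X, rfl⟩
    exact sub_rank_le hU hV d τ X

theorem S_isGreatest {τ : ℝ} (hτ : 0 < τ) (Z : Matrix (Fin M) (Fin N) 𝕜) :
    IsGreatest (Set.range fun X : Matrix (Fin M) (Fin N) 𝕜 =>
      2 * frobInner X Z - ‖X‖ ^ 2 - τ ^ 2 * X.rank) (S τ Z) := by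
  obtain ⟨U, V, hU, hV, hZ⟩ := exists_svd Z
  have h := isGreatest_sum_max_sq_sub hU hV hτ (d := fun i => sv Z i) fun i => sv_nonneg Z i
  rw [← hZ] at h
  rwa [S, sum_range_sv Z (g := fun s => max (s ^ 2 - τ ^ 2) 0) (by simp [sq_nonneg])]

/-- Uniqueness of the maximum spares computing the singular values of the product. -/
theorem S_mul_diagonal_mul {U : Matrix (Fin M) (Fin n) 𝕜}
    {V : Matrix (Fin N) (Fin n) 𝕜} (hU : Uᴴ * U = 1) (hV : Vᴴ * V = 1) {τ : ℝ} (hτ : 0 < τ)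
    {d : Fin n → ℝ} (hd : ∀ i, 0 ≤ d i) :
    S τ (U * Matrix.diagonal (fun i => (d i : 𝕜)) * Vᴴ) = ∑ i, max (d i ^ 2 - τ ^ 2) 0 :=
  (S_isGreatest hτ _).unique (isGreatest_sum_max_sq_sub hU hV hτ hd)

theorem R_isGreatest {τ : ℝ} (hτ : 0 < τ) (A : Matrix (Fin M) (Fin N) 𝕜) :
    IsGreatest (Set.range fun Z : Matrix (Fin M) (Fin N) 𝕜 => 2 * frobInner A Z - S τ Z)
      (R τ A + ‖A‖ ^ 2) := by
  obtain ⟨U, V, hU, hV, hA⟩ := exists_svd A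
  set a : Fin A.rank → ℝ := fun i => sv A i with ha
  have ha0 : ∀ i, 0 ≤ a i := fun i => sv_nonneg A i
  have hnorm : ‖A‖ ^ 2 = ∑ i, a i * a i := by
    rw [← frobInner_self, ← frobInner_diagonal_diagonal hU hV a a, ← hA]
  have hR : R τ A + ‖A‖ ^ 2 = ∑ i, (τ ^ 2 - max (τ - a i) 0 ^ 2 + a i * a i) := by
    rw [R, sum_range_sv A (g := fun s => τ ^ 2 - max (τ - s) 0 ^ 2) (by simp [hτ.le]), hnorm,
      ← Finset.sum_add_distrib]
  rw [hR]
  constructor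
  -- Raising singular values below `τ` to `τ` increases the pairing and leaves `S` at zero there.
  · refine ⟨U * Matrix.diagonal (fun i => ((max (a i) τ : ℝ) : 𝕜)) * Vᴴ, ?_⟩
    have h1 : frobInner A (U * Matrix.diagonal (fun i => ((max (a i) τ : ℝ) : 𝕜)) * Vᴴ) =
        ∑ i, a i * max (a i) τ := by
      rw [← frobInner_diagonal_diagonal hU hV a fun i => max (a i) τ, ← hA]
    beta_reduce
    rw [h1, S_mul_diagonal_mul hU hV hτ (d := fun i => max (a i) τ) fun i =>
      (ha0 i).trans (le_max_left _ _), Finset.mul_sum, ← Finset.sum_sub_distrib]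
    refine Finset.sum_congr rfl fun i _ => ?_
    rcases le_total (a i) τ with h | h
    · rw [max_eq_right h, max_eq_left (sub_nonneg.2 h), sub_self, max_self]
      ring
    · rw [max_eq_left h, max_eq_right (sub_nonpos.2 h),
        max_eq_left (sub_nonneg.2 (pow_le_pow_left₀ hτ.le h 2))]
      ring
  · rintro _ ⟨Z, rfl⟩
    set z : Fin A.rank → ℝ := fun i => RCLike.re ((Uᴴ * Z * V) i i) with hz
    -- In the singular frame of `A`, this bounds `S τ Z` below by the diagonal `z` alone, so the
    -- problem splits into scalar ones.
    obtain ⟨X, hX⟩ := sum_max_sq_sub_le hU hV hτ Z z fun i => rfl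
    have hS := hX.trans ((S_isGreatest hτ Z).2 ⟨X, rfl⟩)
    have h1 : frobInner A Z = ∑ i, a i * z i := by
      rw [hz, ← frobInner_diagonal_left, ← hA]
    have h2 : 2 * ∑ i, a i * z i - ∑ i, (if τ < z i then z i ^ 2 - τ ^ 2 else 0) ≤
        ∑ i, (τ ^ 2 - max (τ - a i) 0 ^ 2 + a i * a i) := by
      rw [Finset.mul_sum, ← Finset.sum_sub_distrib]
      refine Finset.sum_le_sum fun i _ => ?_
      have hi := ha0 i
      rcases le_total (a i) τ with h | h
      · rw [max_eq_left (sub_nonneg.2 h)]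
        split_ifs with h'
        · nlinarith [mul_nonneg (sub_nonneg.2 h) (sub_nonneg.2 h'.le), sq_nonneg (z i - τ)]
        · nlinarith [mul_nonneg hi (sub_nonneg.2 (not_lt.1 h'))]
      · rw [max_eq_right (sub_nonpos.2 h)]
        split_ifs with h'
        · nlinarith [sq_nonneg (a i - z i)]
        · nlinarith [mul_nonneg hi (sub_nonneg.2 (not_lt.1 h')), sq_nonneg (a i - τ)]
    simp only [h1]
    linarith

end

end RankEnvelope

/-! ### Biconjugates and convex envelopes. -/

section FenchelGeneral

theorem IsFenchelConjugate.convexOn {E : Type*} [AddCommGroup E] [Module ℝ E]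
    {b : E → E → ℝ} {f g : E → ℝ} (hb : ∀ x, ConvexOn ℝ Set.univ (b x))
    (h : IsFenchelConjugate b f g) : ConvexOn ℝ Set.univ g := by
  refine ⟨convex_univ, fun y₁ _ y₂ _ s t hs ht hst => ?_⟩
  obtain ⟨x, hx⟩ := (h (s • y₁ + t • y₂)).1
  have h1 := mul_le_mul_of_nonneg_left ((h y₁).2 ⟨x, rfl⟩) hs
  have h2 := mul_le_mul_of_nonneg_left ((h y₂).2 ⟨x, rfl⟩) ht
  have h3 := (hb x).2 (Set.mem_univ y₁) (Set.mem_univ y₂) hs ht hst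
  have h4 : s * f x + t * f x = f x := by rw [← add_mul, hst, one_mul]
  simp only [smul_eq_mul] at h3 ⊢
  linarith

/-- The Fenchel bi-conjugate of a function on a finite-dimensional space is its convex envelope. -/
theorem isConvexEnvelope_of_biconjugate {E : Type*} [NormedAddCommGroup E] [NormedSpace ℝ E]
    [FiniteDimensional ℝ E] {b : E → E → ℝ} {f g k : E → ℝ}
    (hb : ∀ x, ConvexOn ℝ Set.univ (b x)) (hcomm : ∀ x y, b x y = b y x)
    (hriesz : ∀ l : E →ₗ[ℝ] ℝ, ∃ y, ∀ x, l x = b x y)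
    (hg : IsFenchelConjugate b f g) (hk : IsFenchelConjugate b g k) :
    IsConvexEnvelope f k := by
  refine ⟨⟨hk.convexOn hb, fun x => ?_⟩, fun h hh x => ?_⟩
  · obtain ⟨y, hy⟩ := (hk x).1
    have h1 := (hg y).2 ⟨x, rfl⟩
    have h2 := hcomm x y
    simp only at hy h1
    linarith
  · have hcont : ContinuousOn h Set.univ := hh.1.continuousOn isOpen_univ
    refine le_of_forall_lt fun a ha => ?_
    obtain ⟨a', haa', ha'⟩ := exists_between ha
    -- Since `l + c ≤ h ≤ f`, the conjugate at the slope `y` of `l` is at most `-c`; hence `k x ≥ l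
    -- x + c > a`.
    obtain ⟨l, c, hle, heq⟩ := hh.1.exists_affine_le_of_lt (𝕜 := ℝ) (Set.mem_univ x) ha'
      isClosed_univ hcont.lowerSemicontinuousOn
    obtain ⟨y, hy⟩ := hriesz l
    obtain ⟨w, hw⟩ := (hg y).1
    have h1 := hle ⟨w, Set.mem_univ w⟩
    have h2 := hh.2 w
    have h3 := (hk x).2 ⟨y, rfl⟩
    have h4 := hcomm x y
    have h5 := hy x
    have h6 := hy w
    simp only [ContinuousLinearMap.coe_coe, Pi.add_apply, Set.domRestrict_apply,
      Function.comp_apply, RCLike.re_to_real, Function.const_apply] at *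
    linarith

end FenchelGeneral

namespace RankEnvelope

/-! ### The pairing on pairs of matrices and the conjugates of `K`. -/

section

variable {𝕜 : Type*} [RCLike 𝕜] {M N : ℕ}

theorem pairInner_comm (P Q : Matrix (Fin M) (Fin N) 𝕜 × Matrix (Fin M) (Fin N) 𝕜) :
    pairInner P Q = pairInner Q P := by
  rw [pairInner, pairInner, frobInner_comm P.1, frobInner_comm P.2]

/-- The pairing `pairInner` as a real bilinear form. -/
noncomputable def pairForm : (Matrix (Fin M) (Fin N) 𝕜 × Matrix (Fin M) (Fin N) 𝕜) →ₗ[ℝ]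
    Module.Dual ℝ (Matrix (Fin M) (Fin N) 𝕜 × Matrix (Fin M) (Fin N) 𝕜) :=
  LinearMap.mk₂ ℝ pairInner
    (fun P P' Q => by simp only [pairInner, Prod.fst_add, Prod.snd_add, frobInner_add_left]; ring)
    (fun c P Q => by
      simp only [pairInner, Prod.smul_fst, Prod.smul_snd, frobInner_smul_left, smul_eq_mul]; ring)
    (fun P Q Q' => by simp only [pairInner, Prod.fst_add, Prod.snd_add, frobInner_add_right]; ring)
    (fun c P Q => by
      simp only [pairInner, Prod.smul_fst, Prod.smul_snd, frobInner_smul_right, smul_eq_mul]; ring)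

theorem pairForm_apply (P Q : Matrix (Fin M) (Fin N) 𝕜 × Matrix (Fin M) (Fin N) 𝕜) :
    pairForm P Q = pairInner P Q := rfl

theorem convexOn_pairInner (P : Matrix (Fin M) (Fin N) 𝕜 × Matrix (Fin M) (Fin N) 𝕜) :
    ConvexOn ℝ Set.univ (pairInner P) :=
  (pairForm P).convexOn convex_univ

theorem finiteDimensional_matrix : FiniteDimensional ℝ (Matrix (Fin M) (Fin N) 𝕜) :=
  inferInstanceAs (FiniteDimensional ℝ (Fin M → Fin N → 𝕜))

theorem exists_eq_pairInner
    (l : (Matrix (Fin M) (Fin N) 𝕜 × Matrix (Fin M) (Fin N) 𝕜) →ₗ[ℝ] ℝ) :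
    ∃ Q, ∀ P, l P = pairInner P Q := by
  have := finiteDimensional_matrix (𝕜 := 𝕜) (M := M) (N := N)
  have hinj : Function.Injective (pairForm (𝕜 := 𝕜) (M := M) (N := N)) := by
    rw [injective_iff_map_eq_zero]
    intro P hP
    have h : pairInner P P = 0 := by rw [← pairForm_apply, hP]; rfl
    rw [pairInner, frobInner_self, frobInner_self] at h
    have h1 : ‖P.1‖ ^ 2 = 0 := by nlinarith [sq_nonneg ‖P.1‖, sq_nonneg ‖P.2‖]
    have h2 : ‖P.2‖ ^ 2 = 0 := by nlinarith [sq_nonneg ‖P.1‖, sq_nonneg ‖P.2‖]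
    simp only [ne_eq, OfNat.ofNat_ne_zero, not_false_eq_true, pow_eq_zero_iff, norm_eq_zero]
      at h1 h2
    exact Prod.ext h1 h2
  obtain ⟨Q, hQ⟩ := (LinearMap.injective_iff_surjective_of_finrank_eq_finrank
    (Subspace.dual_finrank_eq).symm).1 hinj l
  exact ⟨Q, fun P => by rw [← hQ, pairForm_apply, pairInner_comm]⟩

/-- The square in `B` has coefficient `p + q = p * q`, by conjugacy of the exponents. -/
theorem pairInner_sub_K (F A B X Y : Matrix (Fin M) (Fin N) 𝕜) (τ : ℝ) {p q : ℝ} (hq : 1 < q)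
    (hpq : p = q / (q - 1)) :
    pairInner (A, B) (X, Y) - K F τ p q (A, B) =
      (2 * frobInner A ((1 / 2 : ℝ) • X + (1 / (2 * q)) • Y + F) - ‖A‖ ^ 2 - τ ^ 2 * A.rank) +
        (q - 1) * ‖(1 / (2 * q)) • Y + F‖ ^ 2 - q * ‖F‖ ^ 2 -
        p * q * ‖B - (1 / q) • A - (1 / p) • ((1 / (2 * q)) • Y + F)‖ ^ 2 := by
  have hq0 : q ≠ 0 := by linarith
  have hq1 : q - 1 ≠ 0 := by linarith
  simp only [pairInner, K, ← frobInner_self, frobInner_sub_left, frobInner_sub_right,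
    frobInner_add_left, frobInner_add_right, frobInner_smul_left, frobInner_smul_right,
    frobInner_comm B A, frobInner_comm Y A, frobInner_comm F A, frobInner_comm Y B,
    frobInner_comm F B, frobInner_comm F Y]
  rw [hpq]
  field_simp
  ring

/-- The scalar `s` stands for the value of `S`, which plays no part in completing the square. -/
theorem pairInner_sub_conjugate (F A B X Y : Matrix (Fin M) (Fin N) 𝕜) (s : ℝ) {p q : ℝ}
    (hq : 1 < q) (hpq : p = q / (q - 1)) :
    pairInner (X, Y) (A, B) - (s + (q - 1) * ‖(1 / (2 * q)) • Y + F‖ ^ 2 - q * ‖F‖ ^ 2) =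
      (2 * frobInner A ((1 / 2 : ℝ) • X + (1 / (2 * q)) • Y + F) - s) - ‖A‖ ^ 2 +
        p * ‖A - B‖ ^ 2 + q * ‖B - F‖ ^ 2 -
        (q - 1) * ‖(1 / (2 * q)) • Y + F - (1 / (q - 1)) • (q • B - A)‖ ^ 2 := by
  have hq0 : q ≠ 0 := by linarith
  have hq1 : q - 1 ≠ 0 := by linarith
  simp only [pairInner, ← frobInner_self, frobInner_sub_left, frobInner_sub_right,
    frobInner_add_left, frobInner_add_right, frobInner_smul_left, frobInner_smul_right,
    frobInner_comm B A, frobInner_comm Y A, frobInner_comm X A, frobInner_comm F A,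
    frobInner_comm Y B, frobInner_comm F B, frobInner_comm F Y]
  rw [hpq]
  field_simp
  ring

theorem isFenchelConjugate_K (F : Matrix (Fin M) (Fin N) 𝕜) {τ p q : ℝ} (hτ : 0 < τ) (hp : 1 < p)
    (hq : 1 < q) (hpq : p = q / (q - 1)) :
    IsFenchelConjugate pairInner (K F τ p q)
      (fun Q => S τ ((1 / 2 : ℝ) • Q.1 + (1 / (2 * q)) • Q.2 + F)
          + (q - 1) * ‖(1 / (2 * q)) • Q.2 + F‖ ^ 2 - q * ‖F‖ ^ 2) := by
  rintro ⟨X, Y⟩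
  have hS := S_isGreatest hτ ((1 / 2 : ℝ) • X + (1 / (2 * q)) • Y + F)
  constructor
  · obtain ⟨A, hA⟩ := hS.1
    refine ⟨(A, (1 / q) • A + (1 / p) • ((1 / (2 * q)) • Y + F)), ?_⟩
    beta_reduce at hA ⊢
    rw [pairInner_sub_K F _ _ X Y τ hq hpq, hA, add_sub_cancel_left, sub_self, norm_zero]
    ring
  · rintro _ ⟨⟨A, B⟩, rfl⟩
    beta_reduce
    rw [pairInner_sub_K F A B X Y τ hq hpq]
    have h1 := hS.2 ⟨A, rfl⟩
    have h2 : 0 ≤ p * q * ‖B - (1 / q) • A - (1 / p) • ((1 / (2 * q)) • Y + F)‖ ^ 2 := by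
      positivity
    simp only at h1
    linarith

theorem isFenchelConjugate_conjugate (F : Matrix (Fin M) (Fin N) 𝕜) {τ p q : ℝ} (hτ : 0 < τ)
    (hq : 1 < q) (hpq : p = q / (q - 1)) :
    IsFenchelConjugate pairInner
      (fun Q => S τ ((1 / 2 : ℝ) • Q.1 + (1 / (2 * q)) • Q.2 + F)
          + (q - 1) * ‖(1 / (2 * q)) • Q.2 + F‖ ^ 2 - q * ‖F‖ ^ 2)
      (fun P => R τ P.1 + p * ‖P.1 - P.2‖ ^ 2 + q * ‖P.2 - F‖ ^ 2) := by
  rintro ⟨A, B⟩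
  have hR := R_isGreatest hτ A
  have hq0 : q ≠ 0 := by linarith
  constructor
  · obtain ⟨Z, hZ⟩ := hR.1
    set G := (1 / (q - 1)) • (q • B - A) with hG
    have hY : (1 / (2 * q)) • ((2 * q) • (G - F)) + F = G := by
      rw [smul_smul, one_div_mul_cancel (by positivity), one_smul, sub_add_cancel]
    -- `X` and `Y` realise any prescribed `Z` and `G` independently, so both terms are optimised at
    -- once.
    have hX : (1 / 2 : ℝ) • ((2 : ℝ) • (Z - G)) + (1 / (2 * q)) • ((2 * q) • (G - F)) + F = Z := by
      rw [add_assoc, hY, smul_smul, one_div_mul_cancel two_ne_zero, one_smul, sub_add_cancel]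
    refine ⟨((2 : ℝ) • (Z - G), (2 * q) • (G - F)), ?_⟩
    beta_reduce at hZ ⊢
    rw [pairInner_sub_conjugate F A B _ _ _ hq hpq, hX, hY, hZ, sub_self, norm_zero]
    ring
  · rintro _ ⟨⟨X, Y⟩, rfl⟩
    beta_reduce
    rw [pairInner_sub_conjugate F A B X Y _ hq hpq]
    have h1 := hR.2 ⟨(1 / 2 : ℝ) • X + (1 / (2 * q)) • Y + F, rfl⟩
    have h2 : 0 ≤ (q - 1) * ‖(1 / (2 * q)) • Y + F - (1 / (q - 1)) • (q • B - A)‖ ^ 2 :=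
      mul_nonneg (by linarith) (sq_nonneg _)
    simp only at h1 ⊢
    linarith

end

end RankEnvelope

theorem theorem3p2 {𝕜 : Type*} [RCLike 𝕜] (M N : ℕ) (F : Matrix (Fin M) (Fin N) 𝕜)
    (τ p q : ℝ) (hτ : 0 < τ) (hp : 1 < p) (hq : 1 < q) (hpq : 1 / p + 1 / q = 1) :
    IsFenchelConjugate RankEnvelope.pairInner
        (RankEnvelope.K F τ p q)
        (fun Q => RankEnvelope.S τ ((1 / 2 : ℝ) • Q.1 + (1 / (2 * q)) • Q.2 + F)
          + (q - 1) * ‖(1 / (2 * q)) • Q.2 + F‖ ^ 2 - q * ‖F‖ ^ 2) ∧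
      IsFenchelConjugate RankEnvelope.pairInner
        (fun Q => RankEnvelope.S τ ((1 / 2 : ℝ) • Q.1 + (1 / (2 * q)) • Q.2 + F)
          + (q - 1) * ‖(1 / (2 * q)) • Q.2 + F‖ ^ 2 - q * ‖F‖ ^ 2)
        (fun P => RankEnvelope.R τ P.1 + p * ‖P.1 - P.2‖ ^ 2 + q * ‖P.2 - F‖ ^ 2) ∧
      IsConvexEnvelope (RankEnvelope.K F τ p q)
        (fun P => RankEnvelope.R τ P.1 + p * ‖P.1 - P.2‖ ^ 2 + q * ‖P.2 - F‖ ^ 2) := by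
  have hpq' : p = q / (q - 1) := by
    have hp0 : p ≠ 0 := by linarith
    have hq0 : q ≠ 0 := by linarith
    have hq1 : q - 1 ≠ 0 := by linarith
    field_simp at hpq ⊢
    linarith
  have := RankEnvelope.finiteDimensional_matrix (𝕜 := 𝕜) (M := M) (N := N)
  have h1 := RankEnvelope.isFenchelConjugate_K F hτ hp hq hpq'
  have h2 := RankEnvelope.isFenchelConjugate_conjugate F hτ hq hpq'
  exact ⟨h1, h2, isConvexEnvelope_of_biconjugate RankEnvelope.convexOn_pairInner
    RankEnvelope.pairInner_comm RankEnvelope.exists_eq_pairInner h1 h2⟩
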